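/- All $C^*$-algebras are unital, over $\mathbb{C}$ and finite-dimensional; $A\otimes B$ is their tensor product (the algebraic one, with its unique $C^*$-norm). An element $x$ is positive if $x=y^*y$ for some $y$; an effect of $A$ is an $e\in A$ with $0\le e\le 1$, and $e^\perp=1-e$. A PU map is a linear map that preserves positive elements and the unit; $\mathbf{C}^*_{\mathrm{PU}}$ is the category of $C^*$-algebras and PU maps, in which the product $A\times A'$ is the direct sum. $\mathcal{Z}(A)$ is the centre of $A$. For an effect $e$ of $A$ let $\mathrm{char}_e\colon A\times A\to A$, $\mathrm{char}_e(a,a')=\sqrt{e}\,a\,\sqrt{e}+\sqrt{1-e}\,a'\,\sqrt{1-e}$. For a PU map $f\colon B\to\mathcal{Z}(A)$ let $\mathrm{gr}(f)\colon A\otimes B\to A$ be the linear map with $\mathrm{gr}(f)(a\otimes b)=a\cdot f(b)$. For an effect $e$ of $A\otimes B$ put $\mathrm{gr}(f)^*(e)=\mathrm{gr}(f)(e)$, and let the joint map be $$f\&e=\mathrm{gr}(f)\circ\mathrm{char}_e\circ(\kappa_2\times\kappa_2)\colon B\times B\to A,\qquad \kappa_2(b)=1\otimes b .$$ **Theorem.**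 Let $A,B$ be finite-dimensional $C^*$-algebras, $f\colon B\to\mathcal{Z}(A)$ a PU map and $e$ an effect of $A\otimes B$. Assume that $s=\mathrm{gr}(f)^*(e)$ and $\mathrm{gr}(f)^*(e^\perp)$ are invertible in $A$. Then $s$ is an effect of $A$; the maps $\mathrm{gr}(f)$, $\mathrm{char}_s$ and $f\&e$ are PU maps; and there is exactly one pair of PU maps $f|e,\ f|e^\perp\colon B\to A$ (that is, of maps $A\to B$ in $(\mathbf{C}^*_{\mathrm{PU}})^{\mathrm{op}}$) with $$\mathrm{char}_{s}\circ\big((f|e)\times(f|e^\perp)\big)=f\&e .$$ They are given, for all $b\in B$, by $$(f|e)(b)=\frac{1}{\sqrt{\mathrm{gr}(f)^*(e)}}\cdot(f\&e)(b,0)\cdot\frac{1}{\sqrt{\mathrm{gr}(f)^*(e)}},$$ $$(f|e^\perp)(b)=\frac{1}{\sqrt{\mathrm{gr}(f)^*(1-e)}}\cdot(f\&e)(0,b)\cdot\frac{1}{\sqrt{\mathrm{gr}(f)^*(1-e)}} .$$ -/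

import Mathlib

open scoped TensorProduct InnerProductSpace

namespace QCond

section CStarTensor

/-- The trace of the left regular representation of a finite-dimensional algebra. -/
noncomputable def regTrace (T : Type*) [Ring T] [Algebra ℂ T] : T →ₗ[ℂ] ℂ :=
  LinearMap.trace ℂ T ∘ₗ (Algebra.lmul ℂ T).toLinearMap

/-- The form `⟪x, y⟫ = tr (x* y)` on `T` is positive definite. -/
def RegPosDef (T : Type*) [Ring T] [StarRing T] [Algebra ℂ T] : Prop :=
  ∀ x : T, x ≠ 0 →
    0 < (regTrace T (star x * x)).re ∧ (regTrace T (star x * x)).im = 0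

theorem regPosDef_cstar (A : Type*) [CStarAlgebra A] [FiniteDimensional ℂ A] : RegPosDef A := by
  intro a ha
  set L := Algebra.lmul ℂ A (star a * a) with hL
  have hsa : IsSelfAdjoint (star a * a) := IsSelfAdjoint.star_mul_self a
  have hspec : spectrum ℂ L = spectrum ℂ (star a * a) := by
    ext μ
    rw [spectrum.mem_iff, spectrum.mem_iff, hL, ← AlgHom.commutes (Algebra.lmul ℂ A) μ, ← map_sub,
      Algebra.lmul_isUnit_iff]
  have htr : regTrace A (star a * a) = L.charpoly.roots.sum :=
    Module.End.trace_eq_sum_roots_charpoly_of_splits (IsAlgClosed.splits _)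
  have hroot : ∀ μ : ℂ, μ ∈ L.charpoly.roots ↔ μ ∈ spectrum ℂ (star a * a) := by
    intro μ
    rw [Polynomial.mem_roots (LinearMap.charpoly_monic L).ne_zero,
      ← Module.End.hasEigenvalue_iff_isRoot_charpoly, Module.End.hasEigenvalue_iff_mem_spectrum,
      hspec]
  have hval : ∀ μ ∈ spectrum ℂ (star a * a), μ = (μ.re : ℂ) ∧ 0 ≤ μ.re := by
    intro μ hμ
    have h1 := hsa.mem_spectrum_eq_re hμ
    refine ⟨h1, ?_⟩
    rw [h1] at hμ
    exact spectrum_star_mul_self_nonneg (μ.re) (by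
      have := (spectrum.algebraMap_mem_iff ℂ (R := ℝ) (a := star a * a) (r := μ.re)).1
      exact this hμ)
  obtain ⟨ν, hν, hν0⟩ : ∃ ν ∈ spectrum ℂ (star a * a), ν ≠ 0 := by
    have hne : star a * a ≠ 0 := (CStarRing.star_mul_self_ne_zero_iff a).2 ha
    have : Nontrivial A := ⟨⟨a, 0, ha⟩⟩
    obtain ⟨k, hk, hkr⟩ := spectrum.exists_nnnorm_eq_spectralRadius (star a * a)
    refine ⟨k, hk, ?_⟩
    rintro rfl
    rw [hsa.spectralRadius_eq_nnnorm] at hkr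
    simp only [nnnorm_zero, ENNReal.coe_zero] at hkr
    exact hne (by simpa using hkr.symm)
  have hre : (regTrace A (star a * a)).re = (L.charpoly.roots.map Complex.re).sum := by
    rw [htr]; exact map_multiset_sum Complex.reAddGroupHom _
  have him : (regTrace A (star a * a)).im = (L.charpoly.roots.map Complex.im).sum := by
    rw [htr]; exact map_multiset_sum Complex.imAddGroupHom _
  constructor
  · rw [hre]
    have hmem : ν.re ∈ L.charpoly.roots.map Complex.re :=
      Multiset.mem_map_of_mem _ ((hroot ν).2 hν)
    have hle := Multiset.single_le_sum (s := L.charpoly.roots.map Complex.re) (by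
      intro x hx
      obtain ⟨μ, hμ, rfl⟩ := Multiset.mem_map.1 hx
      exact (hval μ ((hroot μ).1 hμ)).2) _ hmem
    refine lt_of_lt_of_le (lt_of_le_of_ne (hval ν hν).2 ?_) hle
    intro h0
    apply hν0
    rw [(hval ν hν).1, ← h0]; simp
  · rw [him]
    apply Multiset.sum_eq_zero
    intro x hx
    obtain ⟨μ, hμ, rfl⟩ := Multiset.mem_map.1 hx
    rw [(hval μ ((hroot μ).1 hμ)).1]; simp

theorem RegPosDef.conj_symm {T : Type*} [Ring T] [StarRing T] [Algebra ℂ T] [StarModule ℂ T]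
    (h : RegPosDef T) (x y : T) :
    (starRingEnd ℂ) (regTrace T (star y * x)) = regTrace T (star x * y) := by
  have him : ∀ z : T, (regTrace T (star z * z)).im = 0 := by
    intro z
    by_cases hz : z = 0
    · simp [hz]
    · exact (h z hz).2
  have h1 := him (x + y)
  have h2 := him (x + Complex.I • y)
  simp only [star_add, star_smul, add_mul, mul_add, map_add, smul_mul_assoc, mul_smul_comm,
    map_smul, Complex.add_im, him, smul_eq_mul, Complex.mul_im, Complex.mul_re,
    Complex.star_def, Complex.conj_I, Complex.neg_re, Complex.neg_im, Complex.I_re,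
    Complex.I_im] at h1 h2
  apply Complex.ext <;> simp <;> linarith

theorem RegPosDef.re_nonneg {T : Type*} [Ring T] [StarRing T] [Algebra ℂ T]
    (h : RegPosDef T) (x : T) : 0 ≤ (regTrace T (star x * x)).re := by
  by_cases hz : x = 0
  · simp [hz]
  · exact (h x hz).1.le

/-- The inner product `⟪x, y⟫ = tr (x* y)`. -/
@[reducible]
noncomputable def RegPosDef.core {T : Type*} [Ring T] [StarRing T] [Algebra ℂ T] [StarModule ℂ T]
    (h : RegPosDef T) : InnerProductSpace.Core ℂ T where
  inner x y := regTrace T (star x * y)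
  conj_inner_symm x y := h.conj_symm x y
  re_inner_nonneg x := h.re_nonneg x
  add_left x y z := by simp [add_mul]
  smul_left x y r := by simp
  definite x hx := by
    by_contra h0
    have := (h x h0).1
    rw [show regTrace T (star x * x) = 0 from hx] at this
    simp at this

/-- A finite-dimensional *-algebra that embeds in a C*-algebra is a C*-algebra under the induced
norm. -/
@[reducible]
noncomputable def cstarAlgebraInduced {T S : Type*} [Ring T] [StarRing T] [Algebra ℂ T]
    [StarModule ℂ T] [FiniteDimensional ℂ T] [CStarAlgebra S] (L : T →⋆ₐ[ℂ] S)
    (hL : Function.Injective L) : CStarAlgebra T :=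
  letI nR : NormedRing T := NormedRing.induced T S L hL
  letI nA : NormedAlgebra ℂ T := NormedAlgebra.induced ℂ T S L
  { nR, nA with
    toStarRing := inferInstance
    toStarModule := inferInstance
    toCompleteSpace := FiniteDimensional.complete ℂ T
    toCStarRing := ⟨fun x => by
      change ‖L x‖ * ‖L x‖ ≤ ‖L (star x * x)‖
      rw [map_mul, map_star, CStarRing.norm_star_mul_self]⟩ }

/-- The C*-algebra structure on `T`: it acts faithfully by left multiplication on the Hilbert
space `T` with `⟪x, y⟫ = tr (x* y)`, and carries the operator norm (the unique C*-norm). -/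
@[reducible]
noncomputable def RegPosDef.cstarAlgebra {T : Type*} [Ring T] [StarRing T] [Algebra ℂ T]
    [StarModule ℂ T] [FiniteDimensional ℂ T] (h : RegPosDef T) : CStarAlgebra T :=
  letI nT : NormedAddCommGroup T := h.core.toNormedAddCommGroup
  letI iT : InnerProductSpace ℂ T := InnerProductSpace.ofCore h.core.toCore
  have : CompleteSpace T := FiniteDimensional.complete ℂ T
  let L₀ : T →ₐ[ℂ] (T →L[ℂ] T) :=
    ((Module.End.toContinuousLinearMap T : (T →ₗ[ℂ] T) ≃ₐ[ℂ] (T →L[ℂ] T)) :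
      (T →ₗ[ℂ] T) →ₐ[ℂ] (T →L[ℂ] T)).comp (Algebra.lmul ℂ T)
  have hL : ∀ x y, L₀ x y = x * y := fun x y => rfl
  have hinj : Function.Injective L₀ := fun x y hxy => by
    have := congrArg (fun S : T →L[ℂ] T => S 1) hxy
    simpa [hL] using this
  have hstar : ∀ x, L₀ (star x) = star (L₀ x) := fun x => by
    rw [ContinuousLinearMap.star_eq_adjoint, ContinuousLinearMap.eq_adjoint_iff]
    intro y z
    change regTrace T (star (star x * y) * z) = regTrace T (star y * (x * z))
    simp [mul_assoc]
  cstarAlgebraInduced (S := T →L[ℂ] T) { L₀ with map_star' := hstar } hinj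

theorem regTrace_tmul (A B : Type*) [CStarAlgebra A] [FiniteDimensional ℂ A] [CStarAlgebra B]
    [FiniteDimensional ℂ B] (a : A) (b : B) :
    regTrace (A ⊗[ℂ] B) (a ⊗ₜ[ℂ] b) = regTrace A a * regTrace B b := by
  have : Algebra.lmul ℂ (A ⊗[ℂ] B) (a ⊗ₜ[ℂ] b) =
      TensorProduct.map (Algebra.lmul ℂ A a) (Algebra.lmul ℂ B b) := by
    ext x y; simp
  simp only [regTrace, LinearMap.comp_apply, AlgHom.toLinearMap_apply, this,
    LinearMap.trace_tensorProduct']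

theorem regPosDef_tensor (A B : Type*) [CStarAlgebra A] [FiniteDimensional ℂ A] [CStarAlgebra B]
    [FiniteDimensional ℂ B] : RegPosDef (A ⊗[ℂ] B) := by
  obtain ⟨n, v, hv⟩ : ∃ n : ℕ, ∃ v : Module.Basis (Fin n) ℂ A,
      ∀ i j, regTrace A (star (v i) * v j) = if i = j then 1 else 0 := by
    have h := regPosDef_cstar A
    have key : ∀ (T : Type _) [AddCommGroup T] [Module ℂ T] [FiniteDimensional ℂ T]
        (c : InnerProductSpace.Core ℂ T), ∃ n : ℕ, ∃ v : Module.Basis (Fin n) ℂ T,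
        ∀ i j, c.inner (v i) (v j) = if i = j then 1 else 0 := by
      intro T _ _ _ c
      let nT : NormedAddCommGroup T := c.toNormedAddCommGroup
      let iT : InnerProductSpace ℂ T := InnerProductSpace.ofCore c.toCore
      let b := stdOrthonormalBasis ℂ T
      refine ⟨_, b.toBasis, fun i j => ?_⟩
      have := orthonormal_iff_ite.1 b.orthonormal i j
      simpa using this
    exact key A h.core
  intro x hx
  have hsum : ∃ b : Fin n → B, x = ∑ i, v i ⊗ₜ[ℂ] b i := by
    induction x using TensorProduct.induction_on with
    | zero => exact absurd rfl hx
    | tmul a b =>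
      refine ⟨fun i => v.repr a i • b, ?_⟩
      conv_lhs => rw [← v.sum_repr a, TensorProduct.sum_tmul]
      simp only [TensorProduct.smul_tmul]
    | add y z hy hz =>
      have hy' : ∃ b : Fin n → B, y = ∑ i, v i ⊗ₜ[ℂ] b i := by
        by_cases h0 : y = 0
        · exact ⟨0, by simp [h0]⟩
        · exact hy h0
      have hz' : ∃ b : Fin n → B, z = ∑ i, v i ⊗ₜ[ℂ] b i := by
        by_cases h0 : z = 0
        · exact ⟨0, by simp [h0]⟩
        · exact hz h0
      obtain ⟨b, rfl⟩ := hy'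
      obtain ⟨c, rfl⟩ := hz'
      exact ⟨b + c, by simp [TensorProduct.tmul_add, Finset.sum_add_distrib]⟩
  obtain ⟨b, rfl⟩ := hsum
  have hB := regPosDef_cstar B
  have heq : regTrace (A ⊗[ℂ] B) (star (∑ i, v i ⊗ₜ[ℂ] b i) * ∑ i, v i ⊗ₜ[ℂ] b i) =
      ∑ i, regTrace B (star (b i) * b i) := by
    simp [star_sum, Finset.sum_mul_sum, Algebra.TensorProduct.tmul_mul_tmul, regTrace_tmul, hv]
  rw [heq, Complex.re_sum, Complex.im_sum]
  have him : ∀ z : B, (regTrace B (star z * z)).im = 0 := fun z => by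
    by_cases hz : z = 0
    · simp [hz]
    · exact (hB z hz).2
  refine ⟨?_, Finset.sum_eq_zero fun i _ => him _⟩
  obtain ⟨i, hi⟩ : ∃ i, b i ≠ 0 := by
    by_contra! hall
    exact hx (by simp [hall])
  exact Finset.sum_pos' (fun j _ => hB.re_nonneg _) ⟨i, Finset.mem_univ _, (hB _ hi).1⟩

/-- The tensor product of finite-dimensional C*-algebras: the algebraic tensor product with
`(a ⊗ b)(a' ⊗ b') = aa' ⊗ bb'`, `(a ⊗ b)* = a* ⊗ b*` and its unique C*-norm. -/
noncomputable instance tensorCStarAlgebra (A B : Type*) [CStarAlgebra A] [FiniteDimensional ℂ A]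
    [CStarAlgebra B] [FiniteDimensional ℂ B] : CStarAlgebra (A ⊗[ℂ] B) :=
  (regPosDef_tensor A B).cstarAlgebra

end CStarTensor

/-- `x` is positive: `x = y* y` for some `y`. -/
def IsPos {A : Type*} [Mul A] [Star A] (x : A) : Prop :=
  ∃ y : A, x = star y * y

/-- `e ∈ [0,1]_A`: `0 ≤ e ≤ 1`. -/
def IsEffect {A : Type*} [Ring A] [Star A] (e : A) : Prop :=
  IsPos e ∧ IsPos (1 - e)

/-- Positive unital linear maps (PU maps). -/
structure IsPU {A B : Type*} [Ring A] [Star A] [Algebra ℂ A] [Ring B] [Star B] [Algebra ℂ B]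
    (g : A →ₗ[ℂ] B) : Prop where
  map_one : g 1 = 1
  map_pos : ∀ x : A, IsPos x → IsPos (g x)

/-- The centre `Z(A)` of a C*-algebra, as a *-subalgebra. -/
def centre (A : Type*) [CStarAlgebra A] : StarSubalgebra ℂ A where
  toSubalgebra := Subalgebra.center ℂ A
  star_mem' := fun ha => Set.star_mem_center ha

/-- Multiplication `μ : A ⊗ Z(A) → A`, `a ⊗ z ↦ az`. -/
noncomputable def centreMul (A : Type*) [CStarAlgebra A] : A ⊗[ℂ] centre A →ₗ[ℂ] A :=
  LinearMap.mul' ℂ A ∘ₗ (centre A).subtype.toLinearMap.lTensor A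

/-- The graph map `gr(f) = μ ∘ (id ⊗ f) : A ⊗ B → A`, `a ⊗ b ↦ a f(b)`. -/
noncomputable def gr {A B : Type*} [CStarAlgebra A] [CStarAlgebra B] (f : B →ₗ[ℂ] centre A) :
    A ⊗[ℂ] B →ₗ[ℂ] A :=
  centreMul A ∘ₗ f.lTensor A

/-- The square root `√a`, by continuous functional calculus. -/
noncomputable def csqrt {A : Type*} [CStarAlgebra A] (a : A) : A :=
  cfc (fun t : ℝ => Real.sqrt t) a

/-- The inverse square root `1/√a`, by continuous functional calculus. -/
noncomputable def cisqrt {A : Type*} [CStarAlgebra A] (a : A) : A :=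
  cfc (fun t : ℝ => (Real.sqrt t)⁻¹) a

/-- The characteristic map `char_e : A × A → A`,
`(a, a') ↦ √e a √e + √(1-e) a' √(1-e)`. -/
noncomputable def charMap {A : Type*} [CStarAlgebra A] (e : A) : A × A →ₗ[ℂ] A :=
  (LinearMap.mulLeftRight ℂ (csqrt e, csqrt e)).coprod
    (LinearMap.mulLeftRight ℂ (csqrt (1 - e), csqrt (1 - e)))

/-- The coprojection `κ₂ : B → A ⊗ B`, `b ↦ 1 ⊗ b`. -/
noncomputable def kappa₂ (A B : Type*) [CStarAlgebra A] [CStarAlgebra B] : B →ₗ[ℂ] A ⊗[ℂ] B :=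
  (Algebra.TensorProduct.includeRight : B →ₐ[ℂ] A ⊗[ℂ] B).toLinearMap

/-- The joint probability map `f&e = gr(f) ∘ char_e ∘ (κ₂ × κ₂) : B × B → A`. -/
noncomputable def joint {A B : Type*} [CStarAlgebra A] [FiniteDimensional ℂ A] [CStarAlgebra B]
    [FiniteDimensional ℂ B] (f : B →ₗ[ℂ] centre A) (e : A ⊗[ℂ] B) : B × B →ₗ[ℂ] A :=
  gr f ∘ₗ charMap e ∘ₗ (kappa₂ A B).prodMap (kappa₂ A B)

/-- The pair `(g, h)` fills the triangle: `char_s ∘ (g × h) = f&e` with `s = gr(f)(e)`. -/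
def FillsTriangle {A B : Type*} [CStarAlgebra A] [FiniteDimensional ℂ A] [CStarAlgebra B]
    [FiniteDimensional ℂ B] (f : B →ₗ[ℂ] centre A) (e : A ⊗[ℂ] B) (g h : B →ₗ[ℂ] A) : Prop :=
  charMap (gr f e) ∘ₗ g.prodMap h = joint f e

end QCond

/-! The crux is that `gr f` is positive on all of `A ⊗ B`, not just on elementary tensors
(`isPos_gr`). Because `f` takes values in a commutative algebra, its positivity upgrades to complete
positivity (`exists_map_star_mul_eq_sum`): the matrix `f (bᵢ* bⱼ)` is positive semidefinite at every
character, hence equals `C* C` with central entries. For `y = ∑ aᵢ ⊗ bᵢ` this turns `gr f (y* y)`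
into the sum over `k` of the squares of `∑ᵢ aᵢ Cₖᵢ`.

So `s = gr f e` is an effect with `1 - s = gr f (1 - e)`, and the joint map is a composite of PU
maps. On the two summands of `B × B` the triangle reads `√s g(b) √s = (f&e)(b, 0)` and likewise for
`1 - s` (`fillsTriangle_iff`). Invertibility of `√s` and `√(1 - s)` leaves one solution. It is
unital because `(f&e)(1, 0) = s` and `(f&e)(0, 1) = 1 - s`. -/

open scoped Matrix ComplexOrder MatrixOrder

namespace QCond

/-! ### Cone of positive elements. -/

section Positivity

variable {A : Type*} [CStarAlgebra A]

/-- For the spectral order, being nonnegative is the same as being some `y* y`; this gives access to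
the functional calculus. -/
theorem isPos_iff_isSelfAdjoint_and_spectrum {x : A} :
    IsPos x ↔ IsSelfAdjoint x ∧ ∀ t ∈ spectrum ℝ x, 0 ≤ t := by
  let _ := CStarAlgebra.spectralOrder A
  let _ := CStarAlgebra.spectralOrderedRing A
  refine (CStarAlgebra.nonneg_iff_eq_star_mul_self (a := x)).symm.trans ⟨fun h => ?_, fun h => ?_⟩
  · exact ⟨.of_nonneg h, fun t ht => spectrum_nonneg_of_nonneg h ht⟩
  · rw [← cfc_id ℝ x h.1]
    exact cfc_nonneg h.2

theorem IsPos.isSelfAdjoint {x : A} (hx : IsPos x) : IsSelfAdjoint x :=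
  (isPos_iff_isSelfAdjoint_and_spectrum.1 hx).1

theorem IsPos.sum {ι : Type*} (s : Finset ι) {x : ι → A} (hx : ∀ i ∈ s, IsPos (x i)) :
    IsPos (∑ i ∈ s, x i) := by
  let _ := CStarAlgebra.spectralOrder A
  let _ := CStarAlgebra.spectralOrderedRing A
  exact CStarAlgebra.nonneg_iff_eq_star_mul_self.1
    (Finset.sum_nonneg fun i hi => CStarAlgebra.nonneg_iff_eq_star_mul_self.2 (hx i hi))

theorem IsPos.add {x y : A} (hx : IsPos x) (hy : IsPos y) : IsPos (x + y) := by
  let _ := CStarAlgebra.spectralOrder A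
  let _ := CStarAlgebra.spectralOrderedRing A
  exact CStarAlgebra.nonneg_iff_eq_star_mul_self.1
    (add_nonneg (CStarAlgebra.nonneg_iff_eq_star_mul_self.2 hx)
      (CStarAlgebra.nonneg_iff_eq_star_mul_self.2 hy))

theorem isPos_zero : IsPos (0 : A) := ⟨0, by simp⟩

theorem IsPos.conjugate {x c : A} (hx : IsPos x) (hc : IsSelfAdjoint c) : IsPos (c * x * c) := by
  obtain ⟨y, rfl⟩ := hx
  exact ⟨y * c, by simp [hc.star_eq, mul_assoc]⟩

theorem IsPos.fst {B : Type*} [CStarAlgebra B] {x : A × B} (hx : IsPos x) : IsPos x.1 := by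
  obtain ⟨y, rfl⟩ := hx
  exact ⟨y.1, rfl⟩

theorem IsPos.snd {B : Type*} [CStarAlgebra B] {x : A × B} (hx : IsPos x) : IsPos x.2 := by
  obtain ⟨y, rfl⟩ := hx
  exact ⟨y.2, rfl⟩

theorem IsPos.prodMk {B : Type*} [CStarAlgebra B] {x : A} {y : B} (hx : IsPos x) (hy : IsPos y) :
    IsPos (x, y) := by
  obtain ⟨u, rfl⟩ := hx
  obtain ⟨v, rfl⟩ := hy
  exact ⟨(u, v), rfl⟩

end Positivity

/-! ### Square roots and their inverses. -/

section SquareRoot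

variable {A : Type*} [CStarAlgebra A]

theorem isSelfAdjoint_csqrt (x : A) : IsSelfAdjoint (csqrt x) := cfc_predicate _ x

theorem isSelfAdjoint_cisqrt (x : A) : IsSelfAdjoint (cisqrt x) := cfc_predicate _ x

theorem csqrt_mul_csqrt {x : A} (hx : IsPos x) : csqrt x * csqrt x = x := by
  obtain ⟨hsa, hsp⟩ := isPos_iff_isSelfAdjoint_and_spectrum.1 hx
  rw [csqrt, ← cfc_mul (fun t : ℝ => √t) (fun t : ℝ => √t) x
    Real.continuous_sqrt.continuousOn Real.continuous_sqrt.continuousOn]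
  conv_rhs => rw [← cfc_id ℝ x hsa]
  exact cfc_congr fun t ht => Real.mul_self_sqrt (hsp t ht)

/-- Invertibility keeps `0` out of the spectrum, so `t ↦ 1/√t` is continuous there. -/
theorem cisqrt_mul_csqrt {x : A} (hx : IsPos x) (hu : IsUnit x) : cisqrt x * csqrt x = 1 := by
  obtain ⟨hsa, hsp⟩ := isPos_iff_isSelfAdjoint_and_spectrum.1 hx
  have hpos : ∀ t ∈ spectrum ℝ x, 0 < √t := fun t ht =>
    Real.sqrt_pos.2 ((hsp t ht).lt_of_ne fun h => spectrum.zero_notMem ℝ hu (h ▸ ht))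
  rw [cisqrt, csqrt, ← cfc_mul (fun t : ℝ => (√t)⁻¹) (fun t : ℝ => √t) x
    (Real.continuous_sqrt.continuousOn.inv₀ fun t ht => (hpos t ht).ne')
    Real.continuous_sqrt.continuousOn, ← cfc_one ℝ x hsa]
  exact cfc_congr fun t ht => inv_mul_cancel₀ (hpos t ht).ne'

theorem csqrt_mul_cisqrt {x : A} (hx : IsPos x) (hu : IsUnit x) : csqrt x * cisqrt x = 1 := by
  simpa [(isSelfAdjoint_csqrt x).star_eq, (isSelfAdjoint_cisqrt x).star_eq] using
    congrArg star (cisqrt_mul_csqrt hx hu)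

end SquareRoot

/-! ### Characteristic maps and other PU maps. -/

section PU

variable {A B C : Type*}

theorem IsPU.comp [Ring A] [Star A] [Algebra ℂ A] [Ring B] [Star B] [Algebra ℂ B]
    [Ring C] [Star C] [Algebra ℂ C] {g : B →ₗ[ℂ] C} {f : A →ₗ[ℂ] B} (hg : IsPU g) (hf : IsPU f) :
    IsPU (g ∘ₗ f) :=
  ⟨by simp [hf.map_one, hg.map_one], fun x hx => hg.map_pos _ (hf.map_pos x hx)⟩

theorem charMap_apply [CStarAlgebra A] (e a a' : A) :
    charMap e (a, a') =
      csqrt e * a * csqrt e + csqrt (1 - e) * a' * csqrt (1 - e) := by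
  simp [charMap]

theorem IsEffect.isPU_charMap [CStarAlgebra A] {e : A} (he : IsEffect e) : IsPU (charMap e) where
  map_one := by
    rw [show (1 : A × A) = (1, 1) from rfl, charMap_apply, mul_one, mul_one,
      csqrt_mul_csqrt he.1, csqrt_mul_csqrt he.2, add_sub_cancel]
  map_pos x hx := by
    rw [show x = (x.1, x.2) from rfl, charMap_apply]
    exact (hx.fst.conjugate (isSelfAdjoint_csqrt e)).add
      (hx.snd.conjugate (isSelfAdjoint_csqrt (1 - e)))

variable [CStarAlgebra A] [CStarAlgebra B]

theorem isPU_kappa₂_prodMap : IsPU ((kappa₂ A B).prodMap (kappa₂ A B)) where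
  map_one := rfl
  map_pos x hx := by
    obtain ⟨y, rfl⟩ := hx
    refine ⟨((1 : A) ⊗ₜ[ℂ] y.1, (1 : A) ⊗ₜ[ℂ] y.2), ?_⟩
    have key (b : B) : (1 : A) ⊗ₜ[ℂ] (star b * b) = star ((1 : A) ⊗ₜ[ℂ] b) * (1 : A) ⊗ₜ[ℂ] b := by
      rw [TensorProduct.star_tmul, Algebra.TensorProduct.tmul_mul_tmul]
      simp
    exact Prod.ext (key y.1) (key y.2)

end PU

/-! ### Complete positivity and the graph map. -/

section GraphMap

/-- Distinct characters are linearly independent in the finite-dimensional dual. -/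
theorem characterSpace_finite (Z : Type*) [CommCStarAlgebra Z] [FiniteDimensional ℂ Z] :
    Finite (WeakDual.characterSpace ℂ Z) :=
  Finite.of_injective (fun χ => WeakDual.CharacterSpace.toAlgHom χ) fun χ ψ h => by
    ext z
    exact DFunLike.congr_fun h z

/-- A matrix over a finite-dimensional commutative C*-algebra that is positive semidefinite under
every character has the form `C* C`. -/
theorem exists_eq_conjTranspose_mul_self {Z n : Type*} [CommCStarAlgebra Z] [FiniteDimensional ℂ Z]
    [Fintype n] [DecidableEq n] (M : Matrix n n Z)
    (hM : ∀ χ : WeakDual.characterSpace ℂ Z, (M.map χ).PosSemidef) :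
    ∃ C : Matrix n n Z, M = Cᴴ * C := by
  have := characterSpace_finite Z
  have hC (χ : WeakDual.characterSpace ℂ Z) : ∃ C : Matrix n n ℂ, M.map χ = Cᴴ * C :=
    CStarAlgebra.nonneg_iff_eq_star_mul_self.1 (hM χ).nonneg
  choose C hC using hC
  let G := gelfandStarTransform Z
  -- The character space is finite, hence discrete, so factors chosen separately at each character
  -- form continuous functions and come from `Z` by Gelfand duality.
  refine ⟨Matrix.of fun i j => G.symm ⟨fun χ => C χ i j, continuous_of_discreteTopology⟩, ?_⟩
  have hG (φ : C(WeakDual.characterSpace ℂ Z, ℂ)) (χ : WeakDual.characterSpace ℂ Z) :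
      χ (G.symm φ) = φ χ := DFunLike.congr_fun (G.apply_symm_apply φ) χ
  ext i j
  refine G.injective (ContinuousMap.ext fun χ => ?_)
  change χ (M i j) = χ _
  simpa [Matrix.mul_apply, map_star, hG] using congrFun (congrFun (hC χ) i) j

/-- Over `ℂ`, a real-valued quadratic form already forces the matrix to be Hermitian. -/
theorem posSemidef_of_dotProduct_mulVec_nonneg {n : Type*} [Fintype n] [DecidableEq n]
    {M : Matrix n n ℂ} (hM : ∀ v : n → ℂ, 0 ≤ star v ⬝ᵥ M *ᵥ v) : M.PosSemidef := by
  rw [← Matrix.isPositive_toEuclideanLin_iff, LinearMap.isPositive_iff_complex]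
  intro v
  have h : inner ℂ (M.toEuclideanLin v) v = star (star v.ofLp ⬝ᵥ M *ᵥ v.ofLp) := by
    rw [← inner_conj_symm, EuclideanSpace.inner_eq_star_dotProduct, dotProduct_comm]
    rfl
  have h0 := star_nonneg_iff.2 (hM v.ofLp)
  rw [← h, Complex.nonneg_iff] at h0
  exact ⟨Complex.ext rfl h0.2, h0.1⟩

/-- A positive map from a C*-algebra into a finite-dimensional commutative one is completely
positive. -/
theorem exists_map_star_mul_eq_sum {B Z n : Type*} [CStarAlgebra B] [CommCStarAlgebra Z]
    [FiniteDimensional ℂ Z] [Fintype n] [DecidableEq n] (f : B →ₗ[ℂ] Z)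
    (hf : ∀ x, IsPos x → IsPos (f x)) (b : n → B) :
    ∃ C : Matrix n n Z, ∀ i j, f (star (b i) * b j) = ∑ k, star (C k i) * C k j := by
  obtain ⟨C, hC⟩ := exists_eq_conjTranspose_mul_self
    (Matrix.of fun i j => f (star (b i) * b j)) fun χ => by
      refine posSemidef_of_dotProduct_mulVec_nonneg fun v => ?_
      -- At `χ` the quadratic form of the matrix is `χ (f (w* w))` with `w = ∑ vᵢ bᵢ`, so plain
      -- positivity of `f` suffices.
      obtain ⟨y, hy⟩ := hf _ ⟨∑ i, v i • b i, rfl⟩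
      have h : 0 ≤ χ (f (star (∑ i, v i • b i) * ∑ i, v i • b i)) := by
        rw [hy, map_mul, map_star]
        exact star_mul_self_nonneg _
      convert h using 1
      rw [star_sum, Finset.sum_mul_sum]
      simp [dotProduct, Matrix.mulVec, Finset.mul_sum, mul_left_comm, mul_comm (χ _)]
  refine ⟨C, fun i j => ?_⟩
  simpa [Matrix.mul_apply] using congrFun (congrFun hC i) j

theorem gr_tmul {A B : Type*} [CStarAlgebra A] [CStarAlgebra B] (f : B →ₗ[ℂ] centre A) (a : A) (b : B) :
    gr f (a ⊗ₜ[ℂ] b) = a * (f b : A) := rfl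

variable {A B : Type*} [CStarAlgebra A] [FiniteDimensional ℂ A] [CStarAlgebra B]

/-- The centre as a commutative C*-algebra. -/
@[reducible]
noncomputable def centreCommCStarAlgebra (A : Type*) [CStarAlgebra A] [FiniteDimensional ℂ A] :
    CommCStarAlgebra (centre A) :=
  haveI : IsClosed (centre A : Set A) :=
    Submodule.closed_of_finiteDimensional (Subalgebra.center ℂ A).toSubmodule
  { StarSubalgebra.cstarAlgebra (centre A) with
    mul_comm := fun x y => Subtype.ext (Subalgebra.mem_center_iff.1 y.2 x) }

theorem isPos_gr {f : B →ₗ[ℂ] centre A} (hf : IsPU f) {x : A ⊗[ℂ] B} (hx : IsPos x) :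
    IsPos (gr f x) := by
  obtain ⟨y, rfl⟩ := hx
  obtain ⟨n, a, b, rfl⟩ := TensorProduct.exists_sum_tmul_eq y
  let _ := centreCommCStarAlgebra A
  have : FiniteDimensional ℂ (centre A) :=
    FiniteDimensional.finiteDimensional_submodule (Subalgebra.center ℂ A).toSubmodule
  obtain ⟨C, hC⟩ := exists_map_star_mul_eq_sum f hf.map_pos b
  have hcomm (z : centre A) (u : A) : u * z = z * u := Subalgebra.mem_center_iff.1 z.2 u
  -- Centrality of the entries regroups `aᵢ* aⱼ Cₖᵢ* Cₖⱼ` as `(aᵢ Cₖᵢ)* (aⱼ Cₖⱼ)`.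
  have key : gr f (star (∑ i, a i ⊗ₜ[ℂ] b i) * ∑ i, a i ⊗ₜ[ℂ] b i) =
      ∑ k, star (∑ i, a i * (C k i : A)) * ∑ i, a i * (C k i : A) := by
    simp only [star_sum, Finset.sum_mul_sum, map_sum]
    conv_rhs => rw [Finset.sum_comm]
    refine Finset.sum_congr rfl fun i _ => ?_
    conv_rhs => rw [Finset.sum_comm]
    refine Finset.sum_congr rfl fun j _ => ?_
    rw [TensorProduct.star_tmul, Algebra.TensorProduct.tmul_mul_tmul, gr_tmul, hC]
    change star (a i) * a j * ((∑ k, star (C k i) * C k j : centre A) : A) = _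
    rw [AddSubmonoidClass.coe_finsetSum, Finset.mul_sum]
    refine Finset.sum_congr rfl fun k _ => ?_
    change star (a i) * a j * ((star (C k i) : centre A) * C k j) =
      star (a i * (C k i : A)) * (a j * (C k j : A))
    rw [star_mul, ← StarMemClass.coe_star, ← mul_assoc, mul_assoc (star (a i)), hcomm (star (C k i)),
      ← mul_assoc, hcomm (star (C k i))]
    simp only [mul_assoc]
  rw [key]
  exact IsPos.sum _ fun k _ => ⟨_, rfl⟩

theorem IsPU.gr {f : B →ₗ[ℂ] centre A} (hf : IsPU f) : IsPU (gr f) where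
  map_one := by
    rw [Algebra.TensorProduct.one_def, gr_tmul, hf.map_one]
    exact one_mul 1
  map_pos _ hx := isPos_gr hf hx

theorem IsPU.gr_one_sub {f : B →ₗ[ℂ] centre A} (hf : IsPU f) (e : A ⊗[ℂ] B) :
    QCond.gr f (1 - e) = 1 - QCond.gr f e := by
  rw [map_sub, hf.gr.map_one]

theorem IsPU.isEffect_gr {f : B →ₗ[ℂ] centre A} (hf : IsPU f) {e : A ⊗[ℂ] B} (he : IsEffect e) :
    IsEffect (QCond.gr f e) :=
  ⟨isPos_gr hf he.1, hf.gr_one_sub e ▸ isPos_gr hf he.2⟩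

variable [FiniteDimensional ℂ B]

theorem IsPU.joint {f : B →ₗ[ℂ] centre A} (hf : IsPU f) {e : A ⊗[ℂ] B} (he : IsEffect e) :
    IsPU (joint f e) :=
  hf.gr.comp (he.isPU_charMap.comp isPU_kappa₂_prodMap)

/-- This value is the normalising factor that makes the first conditional unital. -/
theorem joint_one_zero (f : B →ₗ[ℂ] centre A) {e : A ⊗[ℂ] B} (he : IsEffect e) :
    joint f e (1, 0) = gr f e := by
  change gr f (charMap e (1, kappa₂ A B 0)) = _
  rw [map_zero, charMap_apply, mul_one, mul_zero, zero_mul, add_zero, csqrt_mul_csqrt he.1]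

theorem joint_zero_one (f : B →ₗ[ℂ] centre A) {e : A ⊗[ℂ] B} (he : IsEffect e) :
    joint f e (0, 1) = gr f (1 - e) := by
  change gr f (charMap e (kappa₂ A B 0, 1)) = _
  rw [map_zero, charMap_apply, mul_one, mul_zero, zero_mul, zero_add, csqrt_mul_csqrt he.2]

end GraphMap

/-! ### Normalisation and the triangle equation. -/

section Conditional

variable {A B : Type*} [CStarAlgebra A] [CStarAlgebra B]

/-- The map `b ↦ (1/√s) φ(b) (1/√s)`. -/
noncomputable def normalize (s : A) (φ : B →ₗ[ℂ] A) : B →ₗ[ℂ] A :=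
  LinearMap.mulLeftRight ℂ (cisqrt s, cisqrt s) ∘ₗ φ

theorem normalize_apply (s : A) (φ : B →ₗ[ℂ] A) (b : B) :
    normalize s φ b = cisqrt s * φ b * cisqrt s := by
  simp [normalize]

theorem csqrt_mul_normalize_mul_csqrt {s : A} (hs : IsPos s) (hu : IsUnit s) (φ : B →ₗ[ℂ] A)
    (b : B) : csqrt s * normalize s φ b * csqrt s = φ b := by
  rw [normalize_apply]
  calc csqrt s * (cisqrt s * φ b * cisqrt s) * csqrt s
      = (csqrt s * cisqrt s) * φ b * (cisqrt s * csqrt s) := by simp only [mul_assoc]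
    _ = φ b := by rw [csqrt_mul_cisqrt hs hu, cisqrt_mul_csqrt hs hu, one_mul, mul_one]

/-- Conjugation by the invertible `√s` is injective; this yields uniqueness. -/
theorem eq_normalize {s : A} (hs : IsPos s) (hu : IsUnit s) {φ g : B →ₗ[ℂ] A}
    (h : ∀ b, csqrt s * g b * csqrt s = φ b) : g = normalize s φ := by
  ext b
  rw [normalize_apply, ← h b]
  calc g b = (cisqrt s * csqrt s) * g b * (csqrt s * cisqrt s) := by
        rw [csqrt_mul_cisqrt hs hu, cisqrt_mul_csqrt hs hu, one_mul, mul_one]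
    _ = cisqrt s * (csqrt s * g b * csqrt s) * cisqrt s := by simp only [mul_assoc]

theorem isPU_normalize {s : A} (hs : IsPos s) (hu : IsUnit s) {φ : B →ₗ[ℂ] A} (h1 : φ 1 = s)
    (hφ : ∀ x, IsPos x → IsPos (φ x)) : IsPU (normalize s φ) where
  map_one := by
    rw [normalize_apply, h1]
    calc cisqrt s * s * cisqrt s
        = (cisqrt s * csqrt s) * (csqrt s * cisqrt s) := by
          conv_lhs => enter [1, 2]; rw [← csqrt_mul_csqrt hs]
          simp only [mul_assoc]
      _ = 1 := by rw [csqrt_mul_cisqrt hs hu, cisqrt_mul_csqrt hs hu, one_mul]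
  map_pos x hx := by
    rw [normalize_apply]
    exact (hφ x hx).conjugate (isSelfAdjoint_cisqrt s)

/-- A linear map on `B × B` is determined by its restrictions to the two summands, so the equations
for `g` and `h` decouple. -/
theorem fillsTriangle_iff [FiniteDimensional ℂ A] [FiniteDimensional ℂ B] {f : B →ₗ[ℂ] centre A}
    (hf : IsPU f) (e : A ⊗[ℂ] B) (g h : B →ₗ[ℂ] A) :
    FillsTriangle f e g h ↔
      (∀ b, csqrt (gr f e) * g b * csqrt (gr f e) = joint f e (b, 0)) ∧
        ∀ b, csqrt (gr f (1 - e)) * h b * csqrt (gr f (1 - e)) = joint f e (0, b) := by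
  rw [FillsTriangle, hf.gr_one_sub, LinearMap.prod_ext_iff, LinearMap.ext_iff, LinearMap.ext_iff]
  simp [charMap_apply]

end Conditional

end QCond

theorem mainTheorem1 {A B : Type*} [CStarAlgebra A] [FiniteDimensional ℂ A]
    [CStarAlgebra B] [FiniteDimensional ℂ B]
    (f : B →ₗ[ℂ] QCond.centre A) (hf : QCond.IsPU f)
    (e : A ⊗[ℂ] B) (he : QCond.IsEffect e)
    (hs : IsUnit (QCond.gr f e)) (hs' : IsUnit (QCond.gr f (1 - e))) :
    (QCond.IsPU (QCond.gr f) ∧ QCond.IsEffect (QCond.gr f e) ∧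
      QCond.IsPU (QCond.charMap (QCond.gr f e)) ∧ QCond.IsPU (QCond.joint f e)) ∧
    ∃ g h : B →ₗ[ℂ] A,
      (QCond.IsPU g ∧ QCond.IsPU h ∧ QCond.FillsTriangle f e g h) ∧
      (∀ g' h' : B →ₗ[ℂ] A, QCond.IsPU g' → QCond.IsPU h' → QCond.FillsTriangle f e g' h' →
        g' = g ∧ h' = h) ∧
      (∀ b : B, g b = QCond.cisqrt (QCond.gr f e) * QCond.joint f e (b, 0) *
        QCond.cisqrt (QCond.gr f e)) ∧
      (∀ b : B, h b = QCond.cisqrt (QCond.gr f (1 - e)) * QCond.joint f e (0, b) *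
        QCond.cisqrt (QCond.gr f (1 - e))) := by

  have hp := QCond.isPos_gr hf he.1
  have hp' := QCond.isPos_gr hf he.2
  have hj := hf.joint he
  refine ⟨⟨hf.gr, hf.isEffect_gr he, (hf.isEffect_gr he).isPU_charMap, hj⟩,
    QCond.normalize (QCond.gr f e) (QCond.joint f e ∘ₗ .inl ℂ B B),
    QCond.normalize (QCond.gr f (1 - e)) (QCond.joint f e ∘ₗ .inr ℂ B B),
    ⟨?_, ?_, ?_⟩, fun g h _ _ hgh => ?_, QCond.normalize_apply _ _, QCond.normalize_apply _ _⟩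
  · exact QCond.isPU_normalize hp hs (QCond.joint_one_zero f he)
      fun x hx => hj.map_pos _ (hx.prodMk QCond.isPos_zero)
  · exact QCond.isPU_normalize hp' hs' (QCond.joint_zero_one f he)
      fun x hx => hj.map_pos _ (QCond.isPos_zero.prodMk hx)
  · rw [QCond.fillsTriangle_iff hf]
    exact ⟨QCond.csqrt_mul_normalize_mul_csqrt hp hs _,
      QCond.csqrt_mul_normalize_mul_csqrt hp' hs' _⟩
  · rw [QCond.fillsTriangle_iff hf] at hgh
    exact ⟨QCond.eq_normalize hp hs hgh.1, QCond.eq_normalize hp' hs' hgh.2⟩
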